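/- Let $n \ge 1$ be an integer and let $I \subseteq \mathbb{R}$ be an interval (open, half-open or closed, bounded or unbounded). A function $h\colon I \to \mathbb{R}$ is called $n$-convex if for any $n+2$ distinct points $t_0, \ldots, t_{n+1}$ of $I$ the divided difference $$[t_0,\ldots,t_{n+1};h] = \sum_{i=0}^{n+1} \frac{h(t_i)}{\prod_{j \ne i}(t_i - t_j)}$$ is nonnegative. For an $n$-convex function $g\colon I\to\mathbb{R}$, a function $f\colon I\to\mathbb{R}$ is called $n$-convex with respect to $g$ if $f-g$ is $n$-convex. Let $\Pi_n$ denote the set of real polynomials of degree at most $n$. Theorem. Let $f, g \colon I \to \mathbb{R}$ be two $n$-convex functions such that $f$ is $n$-convex with respect to $g$. Let $1 \le k \le n$, let $x_1 < \cdots < x_k$ be points of $I$, and let $l_1, \ldots, l_k \ge 1$ be integers (the multiplicities of the points) with $l_1 + \cdots + l_k = n+1$. Assume that $l_1 = 1$ if $x_1 = \inf I$, and that $l_k = 1$ if $x_k = \sup I$. Then there exists a polynomial $p \in \Pi_n$ such that $$f(x_j) = g(x_j) + p(x_j), \qquad j = 1, \ldots, k,$$ and $$(-1)^{n+1}\,[f(x)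 - (g(x)+p(x))] \ge 0 \quad \text{for } x \in I,\ x < x_1,$$ $$(-1)^{n+1-(l_1+\cdots+l_j)}\,[f(x) - (g(x)+p(x))] \ge 0 \quad \text{for } x_j < x < x_{j+1},\ j = 1, \ldots, k-1,$$ $$f(x) - (g(x)+p(x)) \ge 0 \quad \text{for } x \in I,\ x > x_k.$$ A function $g+p$ with these properties is called a support of $(l_1,\ldots,l_k)$-type for $f$. -/

import Mathlib

noncomputable section

/-- The divided difference of `f` at the finitely many distinct points of `s`:
`[t_0, …, t_m; f] = ∑ i, f(t_i) / ∏_{j ≠ i} (t_i - t_j)`, where `s = {t_0, …, t_m}`. -/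
def dividedDifference (f : ℝ → ℝ) (s : Finset ℝ) : ℝ :=
  ∑ t ∈ s, f t / ∏ u ∈ s.erase t, (t - u)

/-- `f` is `n`-convex on `I` in Popoviciu's sense: all its divided differences at `n + 2` distinct
points of `I` are nonnegative. Only the values of `f` on `I` matter. -/
def NConvexOn (n : ℕ) (I : Set ℝ) (f : ℝ → ℝ) : Prop :=
  ∀ s : Finset ℝ, (s : Set ℝ) ⊆ I → s.card = n + 2 → 0 ≤ dividedDifference f s

/-- `f` is `n`-convex with respect to the `n`-convex function `g` on `I`. -/
def NConvexOnWithRespectTo (n : ℕ) (I : Set ℝ) (f g : ℝ → ℝ) : Prop :=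
  NConvexOn n I g ∧ NConvexOn n I (fun x => f x - g x)

/-- For points `x 1 < … < x k` of `I` with positive multiplicities `l 1, …, l k` of sum `n + 1`,
the function `h` is a support of `(l 1, …, l k)`-type for `f` on `I`: it agrees with `f` at the
points, and the sign of `f - h` is prescribed to the left of all of them, between consecutive ones,
and to the right of all of them. As the partial sums of the multiplicities are at most `n + 1`,
the subtraction of natural numbers below is a true one. -/
structure IsSupportOfType (n : ℕ) (I : Set ℝ) (k : ℕ) (x : ℕ → ℝ) (l : ℕ → ℕ)
    (f h : ℝ → ℝ) : Prop where
  eq_at : ∀ j, 1 ≤ j → j ≤ k → f (x j) = h (x j)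
  left : ∀ y ∈ Set.Iio (x 1) ∩ I, 0 ≤ (-1 : ℝ) ^ (n + 1) * (f y - h y)
  between : ∀ j, 1 ≤ j → j < k → ∀ y ∈ Set.Ioo (x j) (x (j + 1)),
    0 ≤ (-1 : ℝ) ^ (n + 1 - ∑ i ∈ Finset.Icc 1 j, l i) * (f y - h y)
  right : ∀ y ∈ Set.Ioi (x k) ∩ I, 0 ≤ f y - h y

end

open Filter Topology

/-! Put `h = f - g`. It suffices to interpolate `h` at the nodes with multiplicity by `p` so that `h
- p` has the sign of the nodal polynomial; the parity of its factors then gives every sign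
condition. This goes by induction on the multiset of nodes (`exists_polynomial_sign_sub`). Peeling
off a node `a` replaces `h` by its slope at `a`, whose divided differences are those of `h` with `a`
adjoined (`dividedDifference_slope`). If `q` solves the problem for the slope, `h a + (X - a) q`
solves it for `h`. The slope has no intrinsic value at `a`; when `a` occurs again, a cluster value
from the right serves as a substitute for the derivative (`exists_update_dividedDifference_nonneg`),
so no differentiability is needed. -/

/-! ### Algebra of divided differences. -/

theorem dividedDifference_insert (f : ℝ → ℝ) {s : Finset ℝ} {a : ℝ} (ha : a ∉ s) :
    dividedDifference f (insert a s) =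
      f a / ∏ u ∈ s, (a - u) + ∑ t ∈ s, f t / ((t - a) * ∏ u ∈ s.erase t, (t - u)) := by
  unfold dividedDifference
  rw [Finset.sum_insert ha, Finset.erase_insert ha]
  congr 1
  refine Finset.sum_congr rfl fun t ht => ?_
  have hta : a ≠ t := fun h => ha (h ▸ ht)
  rw [Finset.erase_insert_of_ne hta, Finset.prod_insert (fun h => ha (Finset.mem_of_mem_erase h))]

/-- Barycentric identity: the divided difference of a constant function vanishes. -/
theorem inv_prod_sub_eq_neg_sum {s : Finset ℝ} {a : ℝ} (hs : s.Nonempty) (ha : a ∉ s) :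
    1 / ∏ u ∈ s, (a - u) = -∑ t ∈ s, 1 / ((t - a) * ∏ u ∈ s.erase t, (t - u)) := by
  have h := congrArg (Polynomial.eval a) (Lagrange.sum_basis (s := s) (v := (id : ℝ → ℝ))
    (Set.injOn_id _) hs)
  have hne : ∀ t ∈ s, a ≠ t := fun t ht h => ha (h ▸ ht)
  have hprod : ∏ u ∈ s, (a - u) ≠ 0 :=
    Finset.prod_ne_zero_iff.2 fun u hu => sub_ne_zero.2 (hne u hu)
  rw [Polynomial.eval_finsetSum, Polynomial.eval_one] at h
  -- The numerator `1` becomes the sum of the Lagrange basis polynomials at `a`, to be compared term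
  -- by term.
  nth_rewrite 1 [← h]
  rw [Finset.sum_div, ← Finset.sum_neg_distrib]
  refine Finset.sum_congr rfl fun t ht => ?_
  rw [Lagrange.eval_basis_not_at_node ht (hne t ht), Lagrange.eval_nodal, Lagrange.nodalWeight]
  have h1 : t - a ≠ 0 := sub_ne_zero.2 (hne t ht).symm
  have h2 : a - t ≠ 0 := sub_ne_zero.2 (hne t ht)
  have h3 : ∏ u ∈ s.erase t, (t - u) ≠ 0 :=
    Finset.prod_ne_zero_iff.2 fun u hu => sub_ne_zero.2 (Finset.ne_of_mem_erase hu).symm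
  simp only [id, Finset.prod_inv_distrib]
  field_simp
  ring

/-- Dividing out a node lowers the order of the divided difference by one. -/
theorem dividedDifference_slope {h φ : ℝ → ℝ} {s : Finset ℝ} {a : ℝ} (hs : s.Nonempty)
    (ha : a ∉ s) (hφ : ∀ t ∈ s, φ t = (h t - h a) / (t - a)) :
    dividedDifference φ s = dividedDifference h (insert a s) := by
  rw [dividedDifference_insert h ha, div_eq_mul_one_div (h a), inv_prod_sub_eq_neg_sum hs ha,
    mul_neg, Finset.mul_sum, neg_add_eq_sub, ← Finset.sum_sub_distrib, dividedDifference]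
  refine Finset.sum_congr rfl fun t ht => ?_
  rw [hφ t ht, div_div, sub_div, mul_one_div]

theorem dividedDifference_congr {f g : ℝ → ℝ} {s : Finset ℝ} (h : ∀ t ∈ s, f t = g t) :
    dividedDifference f s = dividedDifference g s :=
  Finset.sum_congr rfl fun t ht => by rw [h t ht]

/-! ### Extension across an interior point. -/

theorem continuousAt_prod_sub (r : Finset ℝ) (a : ℝ) :
    ContinuousAt (fun x : ℝ => ∏ u ∈ r, (x - u)) a := by
  fun_prop

theorem continuousAt_sum_div_sub (φ : ℝ → ℝ) {r : Finset ℝ} {a : ℝ} (ha : a ∉ r) :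
    ContinuousAt (fun x : ℝ => ∑ t ∈ r, φ t / ((t - x) * ∏ u ∈ r.erase t, (t - u))) a := by
  refine tendsto_finsetSum _ fun t ht => ?_
  refine Tendsto.div tendsto_const_nhds
    (Continuous.tendsto (by fun_prop) a) (mul_ne_zero ?_ ?_)
  · exact sub_ne_zero.2 fun h => ha (h ▸ ht)
  · exact Finset.prod_ne_zero_iff.2 fun u hu => sub_ne_zero.2 (Finset.ne_of_mem_erase hu).symm

theorem exists_finset_lt_of_mem_nhds {S : Set ℝ} {a : ℝ} (hS : S ∈ 𝓝 a) (N : ℕ) :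
    ∃ r : Finset ℝ, (r : Set ℝ) ⊆ S ∩ Set.Iio a ∧ r.card = N := by
  obtain ⟨b, hb, hbS⟩ := exists_Ioc_subset_of_mem_nhds hS (exists_lt a)
  have : (S ∩ Set.Iio a).Infinite :=
    (Set.Ioo_infinite hb).mono fun x hx => ⟨hbS (Set.Ioo_subset_Ioc_self hx), hx.2⟩
  exact this.exists_subset_card_eq N

/-- A function with nonnegative divided differences of a fixed positive order off an interior
point is bounded on a right neighbourhood of that point. -/
theorem exists_eventually_mem_Icc_nhdsGT {S : Set ℝ} {a : ℝ} (hS : S ∈ 𝓝 a) {N : ℕ} {φ : ℝ → ℝ}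
    (hφ : ∀ s : Finset ℝ, (s : Set ℝ) ⊆ S \ {a} → s.card = N + 1 + 1 →
      0 ≤ dividedDifference φ s) :
    ∃ A B : ℝ, ∀ᶠ x in 𝓝[>] a, φ x ∈ Set.Icc A B := by
  -- Solving the divided difference at `insert x r` for `φ x` bounds it by a function continuous at
  -- `a`, on the side given by the sign of `∏ u ∈ r, (x - u)`.
  have key : ∀ r : Finset ℝ, (r : Set ℝ) ⊆ S \ {a} → r.card = N + 1 → ∃ G : ℝ → ℝ,
      ContinuousAt G a ∧ ∀ᶠ x in 𝓝[>] a, 0 ≤ (φ x - G x) / ∏ u ∈ r, (x - u) := by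
    intro r hr hcard
    have har : a ∉ r := fun h => (hr h).2 rfl
    refine ⟨_, ((continuousAt_prod_sub r a).mul (continuousAt_sum_div_sub φ har)).neg, ?_⟩
    have hrc : ∀ᶠ x in 𝓝[>] a, x ∉ r :=
      nhdsWithin_le_nhds (r.finite_toSet.isClosed.isOpen_compl.mem_nhds har)
    filter_upwards [hrc, nhdsWithin_le_nhds hS, self_mem_nhdsWithin] with x hxr hxS hxa
    have hnn := hφ (insert x r) (by
      rw [Finset.coe_insert]
      exact Set.insert_subset ⟨hxS, (ne_of_gt hxa : x ≠ a)⟩ hr)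
      (by rw [Finset.card_insert_of_notMem hxr, hcard])
    rw [dividedDifference_insert φ hxr] at hnn
    have hprod : ∏ u ∈ r, (x - u) ≠ 0 :=
      Finset.prod_ne_zero_iff.2 fun u hu => sub_ne_zero.2 fun h => hxr (h ▸ hu)
    convert hnn using 1
    simp only [Pi.mul_apply, Pi.neg_apply]
    field_simp
    ring
  -- All nodes left of `a` give a lower bound; moving one node to `b > a` flips the sign and gives
  -- an upper bound.
  obtain ⟨r, hrS, hrcard⟩ := exists_finset_lt_of_mem_nhds hS (N + 1)
  obtain ⟨r', hrS', hrcard'⟩ := exists_finset_lt_of_mem_nhds hS N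
  obtain ⟨b, hba, hbS⟩ : ∃ b, a < b ∧ b ∈ S := by
    have : ∀ᶠ x in 𝓝[>] a, a < x ∧ x ∈ S :=
      (eventually_mem_nhdsWithin (s := Set.Ioi a)).and (nhdsWithin_le_nhds hS)
    exact this.exists
  have hbr : b ∉ r' := fun h => absurd (hrS' h).2 (not_lt.2 hba.le)
  obtain ⟨G, hG, hGr⟩ := key r (fun t ht => ⟨(hrS ht).1, (ne_of_lt (hrS ht).2 : t ≠ a)⟩) hrcard
  obtain ⟨K, hK, hKr⟩ := key (insert b r') (by
    rw [Finset.coe_insert]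
    exact Set.insert_subset ⟨hbS, (ne_of_gt hba : b ≠ a)⟩
      fun t ht => ⟨(hrS' ht).1, (ne_of_lt (hrS' ht).2 : t ≠ a)⟩)
    (by rw [Finset.card_insert_of_notMem hbr, hrcard'])
  refine ⟨G a - 1, K a + 1, ?_⟩
  filter_upwards [hGr, hKr, self_mem_nhdsWithin, nhdsWithin_le_nhds (Iio_mem_nhds hba),
    nhdsWithin_le_nhds (hG (Ioi_mem_nhds (sub_one_lt (G a)))),
    nhdsWithin_le_nhds (hK (Iio_mem_nhds (lt_add_one (K a))))] with x hxG hxK hxa hxb hx1 hx2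
  have hpos : 0 < ∏ u ∈ r, (x - u) :=
    Finset.prod_pos fun u hu => sub_pos.2 ((hrS hu).2.trans hxa)
  have hpos' : 0 < ∏ u ∈ r', (x - u) :=
    Finset.prod_pos fun u hu => sub_pos.2 ((hrS' hu).2.trans hxa)
  have hneg : ∏ u ∈ insert b r', (x - u) < 0 := by
    rw [Finset.prod_insert hbr]
    exact mul_neg_of_neg_of_pos (sub_neg.2 hxb) hpos'
  have e1 : 0 ≤ φ x - G x := by
    by_contra hlt
    exact absurd hxG (not_le.2 (div_neg_of_neg_of_pos (not_le.1 hlt) hpos))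
  have e2 : φ x - K x ≤ 0 := by
    by_contra hlt
    exact absurd hxK (not_le.2 (div_neg_of_pos_of_neg (not_le.1 hlt) hneg))
  simp only [Set.mem_preimage, Set.mem_Ioi, Set.mem_Iio] at hx1 hx2
  constructor <;> linarith

/-- Nonnegativity of the divided differences of a fixed positive order extends over an interior
point, for a suitable value of the function there. -/
theorem exists_update_dividedDifference_nonneg {S : Set ℝ} {a : ℝ} (hS : S ∈ 𝓝 a) {N : ℕ}
    {φ : ℝ → ℝ}
    (hφ : ∀ s : Finset ℝ, (s : Set ℝ) ⊆ S \ {a} → s.card = N + 1 + 1 →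
      0 ≤ dividedDifference φ s) :
    ∃ c : ℝ, ∀ s : Finset ℝ, (s : Set ℝ) ⊆ S → s.card = N + 1 + 1 →
      0 ≤ dividedDifference (Function.update φ a c) s := by
  obtain ⟨A, B, hAB⟩ := exists_eventually_mem_Icc_nhdsGT hS hφ
  -- Along an ultrafilter the bounded `φ` converges by compactness, so existence of a one-sided
  -- limit need not be shown.
  let U : Ultrafilter ℝ := Ultrafilter.of (𝓝[>] a)
  have hU : (U : Filter ℝ) ≤ 𝓝[>] a := Ultrafilter.of_le _
  obtain ⟨c, -, hc⟩ := (isCompact_Icc (a := A) (b := B)).ultrafilter_le_nhds (U.map φ)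
    (le_principal_iff.2 (hU hAB))
  refine ⟨c, fun s hs hcard => ?_⟩
  by_cases has : a ∈ s
  · obtain ⟨r, har, rfl⟩ : ∃ r, a ∉ r ∧ insert a r = s :=
      ⟨s.erase a, Finset.notMem_erase a s, Finset.insert_erase has⟩
    have hprod : ∏ u ∈ r, (a - u) ≠ 0 :=
      Finset.prod_ne_zero_iff.2 fun u hu => sub_ne_zero.2 fun h => har (h ▸ hu)
    have hUa : (U : Filter ℝ) ≤ 𝓝 a := hU.trans nhdsWithin_le_nhds
    have hlim := (Tendsto.div (show Tendsto φ U (𝓝 c) from hc)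
      ((continuousAt_prod_sub r a).mono_left hUa) hprod).add
      ((continuousAt_sum_div_sub φ har).mono_left hUa)
    have hval : dividedDifference (Function.update φ a c) (insert a r) =
        c / ∏ u ∈ r, (a - u) + ∑ t ∈ r, φ t / ((t - a) * ∏ u ∈ r.erase t, (t - u)) := by
      rw [dividedDifference_insert _ har, Function.update_self]
      congr 1
      refine Finset.sum_congr rfl fun t ht => ?_
      rw [Function.update_of_ne (ne_of_mem_of_not_mem ht har)]
    rw [hval]
    refine ge_of_tendsto hlim ?_
    have hrc : ∀ᶠ x in 𝓝 a, x ∉ r := r.finite_toSet.isClosed.isOpen_compl.mem_nhds har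
    filter_upwards [hUa hrc, hUa hS, hU self_mem_nhdsWithin] with x hxr hxS hxa
    have hnn := hφ (insert x r) (by
      rw [Finset.coe_insert]
      exact Set.insert_subset ⟨hxS, (ne_of_gt hxa : x ≠ a)⟩ fun t ht =>
        ⟨hs (Finset.mem_insert_of_mem ht), fun h => har (h ▸ ht)⟩)
      (by rw [Finset.card_insert_of_notMem hxr, ← hcard, Finset.card_insert_of_notMem har])
    rwa [dividedDifference_insert φ hxr] at hnn
  · rw [dividedDifference_congr (g := φ) fun t ht =>
      Function.update_of_ne (ne_of_mem_of_not_mem ht has) _ _]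
    exact hφ s (fun t ht => ⟨hs ht, fun h => has (h ▸ ht)⟩) hcard

/-! ### Interpolation with a signed error. -/

/-- A function with nonnegative divided differences admits an interpolating polynomial at
prescribed nodes with multiplicities, such that the error has the sign of the nodal polynomial.
Multiple nodes have to be interior points. -/
theorem exists_polynomial_sign_sub (T : Multiset ℝ) : ∀ (S : Set ℝ) (h : ℝ → ℝ),
    (∀ a ∈ T, a ∈ S) → (∀ a, 2 ≤ T.count a → S ∈ 𝓝 a) →
    (∀ s : Finset ℝ, (s : Set ℝ) ⊆ S → s.card = T.card + 1 → 0 ≤ dividedDifference h s) →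
    ∃ p : Polynomial ℝ, p.degree < T.card ∧ (∀ a ∈ T, h a = p.eval a) ∧
      ∀ y ∈ S, 0 ≤ (h y - p.eval y) * (T.map fun t => y - t).prod := by
  classical
  induction T using Multiset.induction_on with
  | empty =>
    intro S h _ _ hh
    refine ⟨0, by simp, by simp, fun y hy => ?_⟩
    simpa [dividedDifference] using hh {y} (by simpa using hy) (by simp)
  | cons a T ih =>
    intro S h hTS hint hh
    -- It suffices to treat the slope function, on a set containing all points other than `a`.
    have step : ∀ (S' : Set ℝ) (φ : ℝ → ℝ), S \ {a} ⊆ S' →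
        (∀ y, y ≠ a → φ y = (h y - h a) / (y - a)) →
        (∃ q : Polynomial ℝ, q.degree < T.card ∧ (∀ b ∈ T, φ b = q.eval b) ∧
          ∀ y ∈ S', 0 ≤ (φ y - q.eval y) * (T.map fun t => y - t).prod) →
        ∃ p : Polynomial ℝ, p.degree < (a ::ₘ T).card ∧ (∀ b ∈ a ::ₘ T, h b = p.eval b) ∧
          ∀ y ∈ S, 0 ≤ (h y - p.eval y) * ((a ::ₘ T).map fun t => y - t).prod := by
      rintro S' φ hS' hφ ⟨q, hdeg, hq, hsign⟩
      have hfac : ∀ y, y ≠ a →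
          h y - (Polynomial.C (h a) + (Polynomial.X - Polynomial.C a) * q).eval y =
            (y - a) * (φ y - q.eval y) := by
        intro y hy
        have := sub_ne_zero.2 hy
        rw [hφ y hy]
        simp only [Polynomial.eval_add, Polynomial.eval_mul, Polynomial.eval_sub,
          Polynomial.eval_C, Polynomial.eval_X]
        field_simp
        ring
      refine ⟨Polynomial.C (h a) + (Polynomial.X - Polynomial.C a) * q, ?_, ?_, ?_⟩
      · rw [Multiset.card_cons, Nat.cast_add, Nat.cast_one]
        refine (Polynomial.degree_add_le _ _).trans_lt (max_lt ?_ ?_)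
        · refine Polynomial.degree_C_le.trans_lt ?_
          exact_mod_cast Nat.succ_pos _
        · rw [Polynomial.degree_mul, Polynomial.degree_X_sub_C, add_comm]
          exact WithBot.add_lt_add_right (by simp) hdeg
      · intro b hb
        by_cases hba : b = a
        · simp [hba]
        · have hbT : b ∈ T := (Multiset.mem_cons.1 hb).resolve_left hba
          rw [← sub_eq_zero, hfac b hba, hq b hbT, sub_self, mul_zero]
      · intro y hy
        by_cases hya : y = a
        · simp [hya]
        · rw [hfac y hya, Multiset.map_cons, Multiset.prod_cons]
          -- One factor `y - a` comes from the error and one from the nodal polynomial.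
          have := mul_nonneg (sq_nonneg (y - a)) (hsign y (hS' ⟨hy, hya⟩))
          linarith
    have hslope : ∀ s : Finset ℝ, (s : Set ℝ) ⊆ S \ {a} → s.card = T.card + 1 →
        0 ≤ dividedDifference (fun y => (h y - h a) / (y - a)) s := by
      intro s hs hcard
      have has : a ∉ s := fun h => (hs h).2 rfl
      rw [dividedDifference_slope (h := h) (Finset.card_pos.1 (by omega)) has fun _ _ => rfl]
      refine hh _ ?_ (by rw [Finset.card_insert_of_notMem has, hcard, Multiset.card_cons])
      rw [Finset.coe_insert]
      exact Set.insert_subset (hTS a (Multiset.mem_cons_self a T)) (hs.trans Set.sdiff_subset)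
    have hcount : ∀ b, 2 ≤ T.count b → S ∈ 𝓝 b := fun b hb =>
      hint b (hb.trans (Multiset.count_le_of_le b (Multiset.le_cons_self T a)))
    -- A repeated node must stay in the domain, so the slope is extended over it; otherwise `a` is
    -- simply removed.
    by_cases haT : a ∈ T
    · have hSa : S ∈ 𝓝 a := hint a (by
        rw [Multiset.count_cons_self]
        have := Multiset.one_le_count_iff_mem.2 haT
        omega)
      obtain ⟨N, hN⟩ : ∃ N, T.card = N + 1 :=
        Nat.exists_eq_succ_of_ne_zero (Multiset.card_pos_iff_exists_mem.2 ⟨a, haT⟩).ne'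
      rw [hN] at hslope
      obtain ⟨c, hc⟩ := exists_update_dividedDifference_nonneg hSa hslope
      rw [← hN] at hc
      exact step S _ Set.sdiff_subset (fun y hy => Function.update_of_ne hy _ _)
        (ih S _ (fun b hb => hTS b (Multiset.mem_cons_of_mem hb)) hcount hc)
    · refine step (S \ {a}) _ subset_rfl (fun y _ => rfl) (ih (S \ {a}) _ ?_ ?_ hslope)
      · exact fun b hb => ⟨hTS b (Multiset.mem_cons_of_mem hb), fun h => haT (h ▸ hb)⟩
      · intro b hb
        have hbT : b ∈ T := Multiset.one_le_count_iff_mem.1 (by omega)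
        exact inter_mem (hcount b hb)
          (isOpen_ne.mem_nhds fun h : b = a => haT (h ▸ hbT))

/-! ### From the nodal sign to supports. -/

theorem mem_nhds_of_ordConnected {I : Set ℝ} (hI : I.OrdConnected) {a b c : ℝ} (hb : b ∈ I)
    (hc : c ∈ I) (hba : b < a) (hac : a < c) : I ∈ 𝓝 a :=
  mem_of_superset (Icc_mem_nhds hba hac) (hI.out hb hc)

/-- The product over nodes above `y` has sign given by the parity of their total multiplicity. -/
theorem prod_sub_pow_eq_neg_one_pow_mul (s : Finset ℕ) (x : ℕ → ℝ) (l : ℕ → ℕ) (y : ℝ) :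
    ∏ i ∈ s, (y - x i) ^ l i = (-1) ^ (∑ i ∈ s, l i) * ∏ i ∈ s, (x i - y) ^ l i := by
  rw [← Finset.prod_pow_eq_pow_sum, ← Finset.prod_mul_distrib]
  refine Finset.prod_congr rfl fun i _ => ?_
  rw [← mul_pow]
  congr 1
  ring

/-- Factors up to index `j` are positive, and the later ones contribute one sign per multiplicity.
Allowing `j = 0` and `j = k` covers the two outer regions as well. -/
theorem neg_one_pow_mul_nonneg_of_mul_prod_nonneg {n k : ℕ} {x : ℕ → ℝ} {l : ℕ → ℕ}
    (hsum : ∑ j ∈ Finset.Icc 1 k, l j = n + 1) {j : ℕ} (hj : j ≤ k) {y d : ℝ}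
    (hlo : ∀ i, 1 ≤ i → i ≤ j → x i < y) (hhi : ∀ i, j < i → i ≤ k → y < x i)
    (h : 0 ≤ d * ∏ i ∈ Finset.Icc 1 k, (y - x i) ^ l i) :
    0 ≤ (-1 : ℝ) ^ (n + 1 - ∑ i ∈ Finset.Icc 1 j, l i) * d := by
  have hun : Finset.Icc 1 k = Finset.Icc 1 j ∪ Finset.Ioc j k := by
    ext i
    simp only [Finset.mem_Icc, Finset.mem_union, Finset.mem_Ioc]
    omega
  have hdis : Disjoint (Finset.Icc 1 j) (Finset.Ioc j k) := by
    rw [Finset.disjoint_left]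
    intro i
    simp only [Finset.mem_Icc, Finset.mem_Ioc]
    omega
  rw [hun, Finset.sum_union hdis] at hsum
  rw [hun, Finset.prod_union hdis, prod_sub_pow_eq_neg_one_pow_mul (Finset.Ioc j k)] at h
  rw [← hsum, Nat.add_sub_cancel_left]
  have h1 : 0 < ∏ i ∈ Finset.Icc 1 j, (y - x i) ^ l i := Finset.prod_pos fun i hi => by
    rw [Finset.mem_Icc] at hi
    exact pow_pos (sub_pos.2 (hlo i hi.1 hi.2)) _
  have h2 : 0 < ∏ i ∈ Finset.Ioc j k, (x i - y) ^ l i := Finset.prod_pos fun i hi => by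
    rw [Finset.mem_Ioc] at hi
    exact pow_pos (sub_pos.2 (hhi i hi.1 hi.2)) _
  refine nonneg_of_mul_nonneg_left (b := (∏ i ∈ Finset.Icc 1 j, (y - x i) ^ l i) *
    ∏ i ∈ Finset.Ioc j k, (x i - y) ^ l i) ?_ (mul_pos h1 h2)
  linarith

theorem theorem5p2 (n : ℕ) (hn : 1 ≤ n) (I : Set ℝ) (hI : I.OrdConnected) (f g : ℝ → ℝ)
    (hf : NConvexOn n I f) (hg : NConvexOn n I g) (hfg : NConvexOnWithRespectTo n I f g)
    (k : ℕ) (hk : 1 ≤ k) (hkn : k ≤ n)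
    (x : ℕ → ℝ) (hxI : ∀ j, 1 ≤ j → j ≤ k → x j ∈ I)
    (hx : ∀ j, 1 ≤ j → j < k → x j < x (j + 1))
    (l : ℕ → ℕ) (hl : ∀ j, 1 ≤ j → j ≤ k → 1 ≤ l j)
    (hsum : ∑ j ∈ Finset.Icc 1 k, l j = n + 1)
    (hinf : IsGLB I (x 1) → l 1 = 1) (hsup : IsLUB I (x k) → l k = 1) :
    ∃ p : Polynomial ℝ, p.degree ≤ n ∧
      IsSupportOfType n I k x l f (fun y => g y + p.eval y) := by
  classical
  have hmono : ∀ i j, 1 ≤ i → i < j → j ≤ k → x i < x j := by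
    intro i j hi hij hjk
    induction j, hij using Nat.le_induction with
    | base => exact hx i hi (by omega)
    | succ j hij ih => exact (ih (by omega)).trans (hx j (by omega) (by omega))
  have hmono' : ∀ i j, 1 ≤ i → i ≤ j → j ≤ k → x i ≤ x j := by
    intro i j hi hij hjk
    rcases hij.eq_or_lt with rfl | hij
    · rfl
    · exact (hmono i j hi hij hjk).le
  let T : Multiset ℝ := ∑ j ∈ Finset.Icc 1 k, Multiset.replicate (l j) (x j)
  have hTcard : T.card = n + 1 := by
    rw [← hsum, Multiset.card_sum]
    simp
  have hTmem : ∀ a, a ∈ T ↔ ∃ j ∈ Finset.Icc 1 k, a ∈ Multiset.replicate (l j) (x j) := fun a =>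
    Multiset.mem_sum
  have hTprod : ∀ y, (T.map fun t => y - t).prod = ∏ i ∈ Finset.Icc 1 k, (y - x i) ^ l i := by
    intro y
    have hmap : T.map (fun t => y - t) =
        ∑ j ∈ Finset.Icc 1 k, (Multiset.replicate (l j) (x j)).map fun t => y - t :=
      map_sum (Multiset.mapAddMonoidHom fun t => y - t) _ _
    rw [hmap, Multiset.prod_sum]
    simp
  have hTS : ∀ a ∈ T, a ∈ I := by
    intro a ha
    obtain ⟨j, hj, haj⟩ := (hTmem a).1 ha
    rw [Finset.mem_Icc] at hj
    rw [Multiset.eq_of_mem_replicate haj]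
    exact hxI j hj.1 hj.2
  have hint : ∀ a, 2 ≤ T.count a → I ∈ 𝓝 a := by
    intro a ha
    obtain ⟨j, hj, haj⟩ := (hTmem a).1 (Multiset.one_le_count_iff_mem.1 (by omega))
    obtain rfl := Multiset.eq_of_mem_replicate haj
    have hcount : T.count (x j) = l j := by
      rw [Multiset.count_sum', Finset.sum_eq_single_of_mem j hj]
      · simp
      · intro i hi hij
        rw [Multiset.count_replicate, if_neg]
        rw [Finset.mem_Icc] at hi hj
        rcases lt_or_gt_of_ne hij with h | h
        · exact (hmono i j hi.1 h hj.2).ne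
        · exact (hmono j i hj.1 h hi.2).ne'
    rw [Finset.mem_Icc] at hj
    rw [hcount] at ha
    -- Only an extreme node can be an endpoint of `I`, and there `hinf` or `hsup` excludes
    -- multiplicity at least two.
    obtain ⟨b, hbI, hb⟩ : ∃ b ∈ I, b < x j := by
      rcases hj.1.eq_or_lt with rfl | h1
      · by_contra! hlow
        have := hinf ⟨hlow, fun c hc => hc (hxI 1 le_rfl hk)⟩
        omega
      · exact ⟨x 1, hxI 1 le_rfl hk, hmono 1 j le_rfl h1 hj.2⟩
    obtain ⟨c, hcI, hc⟩ : ∃ c ∈ I, x j < c := by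
      rcases hj.2.eq_or_lt with rfl | h1
      · by_contra! hup
        have := hsup ⟨hup, fun c hc => hc (hxI j hk le_rfl)⟩
        omega
      · exact ⟨x k, hxI k hk le_rfl, hmono j k hj.1 h1 le_rfl⟩
    exact mem_nhds_of_ordConnected hI hbI hcI hb hc
  obtain ⟨p, hdeg, heq, hsign⟩ := exists_polynomial_sign_sub T I (fun y => f y - g y) hTS hint
    fun s hs hcard => hfg.2 s hs (by rw [hcard, hTcard])
  rw [hTcard] at hdeg
  have hs : ∀ j ≤ k, ∀ y ∈ I, (∀ i, 1 ≤ i → i ≤ j → x i < y) →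
      (∀ i, j < i → i ≤ k → y < x i) →
      0 ≤ (-1 : ℝ) ^ (n + 1 - ∑ i ∈ Finset.Icc 1 j, l i) * (f y - (g y + p.eval y)) := by
    intro j hj y hy hlo hhi
    have := hsign y hy
    rw [hTprod, sub_sub] at this
    exact neg_one_pow_mul_nonneg_of_mul_prod_nonneg hsum hj hlo hhi this
  refine ⟨p, Order.lt_succ_iff.1 (by exact_mod_cast hdeg), ?_, ?_, ?_, ?_⟩
  · intro j hj1 hjk
    have := heq (x j) ((hTmem _).2 ⟨j, Finset.mem_Icc.2 ⟨hj1, hjk⟩,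
      Multiset.mem_replicate.2 ⟨Nat.one_le_iff_ne_zero.1 (hl j hj1 hjk), rfl⟩⟩)
    linarith
  · rintro y ⟨hy, hyI⟩
    simpa using hs 0 (Nat.zero_le k) y hyI (fun i h1 h2 => by omega)
      fun i h1 h2 => lt_of_lt_of_le hy (hmono' 1 i le_rfl h1 h2)
  · rintro j hj1 hjk y ⟨hy1, hy2⟩
    exact hs j hjk.le y
      (hI.out (hxI j hj1 hjk.le) (hxI (j + 1) (by omega) hjk) ⟨hy1.le, hy2.le⟩)
      (fun i h1 h2 => (hmono' i j h1 h2 hjk.le).trans_lt hy1)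
      fun i h1 h2 => hy2.trans_le (hmono' (j + 1) i (by omega) h1 h2)
  · rintro y ⟨hy, hyI⟩
    have := hs k le_rfl y hyI (fun i h1 h2 => (hmono' i k h1 h2 le_rfl).trans_lt hy)
      fun i h1 h2 => by omega
    rwa [hsum, Nat.sub_self, pow_zero, one_mul] at this
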